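/- Let $k$ be a field and let $B$ be the bipath poset: its underlying set is $(\mathbb{R}\times\{1,2\})\sqcup\{-\infty,+\infty\}$, and $x\le y$ if and only if $x=-\infty$, or $y=+\infty$, or $x=(s,i)$ and $y=(t,i)$ for some $i\in\{1,2\}$ and $s\le t$ in $\mathbb{R}$. A persistence module over $B$ is a functor from $B$ (viewed as a category) to the category of $k$-vector spaces; it is pointwise finite-dimensional if its value at each point of $B$ is finite-dimensional. An interval of $B$ is a non-empty subset $I\subseteq B$ that is convex (if $p,q\in I$ and $p\le r\le q$, then $r\in I$) and connected (any $p,q\in I$ are joined by a finite sequence $p=z_0,z_1,\dots,z_\ell=q$ in $I$ with $z_{j-1}$ and $z_j$ comparable for all $j$). For an interval $I$, let $k_I$ be the persistence module with $(k_I)_p=k$ if $p\in I$ and $(k_I)_p=0$ otherwise, whose structure map $(k_I)_p\to(k_I)_q$ for $p\le q$ is $\mathrm{id}_k$ if $p,q\in I$ and $0$ otherwise. An interval module is a persistence module isomorphic to $k_I$ for some interval $I$. Then every pointwise finite-dimensional persistence module $V$ over $B$ is isomorphic to a direct sum of interval modules, and this decomposition is unique up to isomorphism and permutation of the summands: if $V\cong\bigoplus_{\lambda\in\Lambda}M_\lambda$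 and $V\cong\bigoplus_{\gamma\in\Gamma}N_\gamma$ with all $M_\lambda$ and $N_\gamma$ interval modules, then there is a bijection $\sigma\colon\Lambda\to\Gamma$ with $M_\lambda\cong N_{\sigma(\lambda)}$ for every $\lambda\in\Lambda$. -/

import Mathlib

open CategoryTheory CategoryTheory.Limits

universe u

/-- The underlying set `(ℝ × {1,2}) ⊔ {±∞}` of the bipath poset; the two branches are indexed
by `Fin 2`. -/
inductive BipathPoset : Type
  | negInf : BipathPoset
  | pt (s : ℝ) (i : Fin 2) : BipathPoset
  | posInf : BipathPoset

namespace BipathPoset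

instance : LE BipathPoset where
  le x y := x = negInf ∨ y = posInf ∨ ∃ (s t : ℝ) (i : Fin 2), x = pt s i ∧ y = pt t i ∧ s ≤ t

theorem le_def (x y : BipathPoset) :
    x ≤ y ↔ x = negInf ∨ y = posInf ∨
      ∃ (s t : ℝ) (i : Fin 2), x = pt s i ∧ y = pt t i ∧ s ≤ t := Iff.rfl

instance : PartialOrder BipathPoset where
  le_refl x := by
    rcases x with _ | ⟨s, i⟩ | _
    · exact Or.inl rfl
    · exact Or.inr (Or.inr ⟨s, s, i, rfl, rfl, le_rfl⟩)
    · exact Or.inr (Or.inl rfl)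
  le_trans x y z := by
    rintro (rfl | rfl | ⟨s, t, i, rfl, rfl, h⟩) (h₁ | rfl | ⟨s', t', i', h₁, rfl, h'⟩)
    all_goals first
      | exact Or.inl rfl
      | exact Or.inr (Or.inl rfl)
      | cases h₁
    exact Or.inr (Or.inr ⟨s, t', i, rfl, rfl, h.trans h'⟩)
  le_antisymm x y := by
    rintro (rfl | rfl | ⟨s, t, i, rfl, rfl, h⟩) (h₁ | h₁ | ⟨s', t', i', h₁, h₂, h'⟩)
    all_goals cases h₁
    all_goals first
      | rfl
      | cases h₂
    rw [le_antisymm h h']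

end BipathPoset

/-- The intervals of a poset: nonempty, convex and connected subsets. Connectivity says that any
two elements are joined by a finite sequence of elements of the subset in which consecutive
elements are comparable. -/
structure PosetInterval (P : Type*) [PartialOrder P] where
  carrier : Set P
  nonempty : carrier.Nonempty
  convex : ∀ p ∈ carrier, ∀ q ∈ carrier, ∀ r : P, p ≤ r → r ≤ q → r ∈ carrier
  connected : ∀ p ∈ carrier, ∀ q ∈ carrier,
    Relation.ReflTransGen (fun x y => x ∈ carrier ∧ y ∈ carrier ∧ (x ≤ y ∨ y ≤ x)) p q

/-- A persistence module over `P`: a functor from `P`, viewed as a category, to `k`-vector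
spaces. -/
abbrev PersistenceModule (k : Type u) [Field k] (P : Type) [PartialOrder P] :=
  P ⥤ ModuleCat.{u} k

section

variable {k : Type u} [Field k] {P : Type} [PartialOrder P]

/-- Pointwise finite-dimensional persistence modules. -/
def IsPfd (V : PersistenceModule k P) : Prop :=
  ∀ p : P, FiniteDimensional k (V.obj p)

variable (k)

open Classical in
/-- The value at `p` of the module `k_I`: it is `k` if `p ∈ I` and `0` otherwise. -/
noncomputable def intervalFiber (I : PosetInterval P) (p : P) : Submodule k k :=
  if p ∈ I.carrier then ⊤ else ⊥

open Classical in
/-- The structure map `k_I(p, q)`: the identity of `k` if `p, q ∈ I`, and `0` otherwise. -/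
noncomputable def intervalMap (I : PosetInterval P) (p q : P) :
    intervalFiber k I p →ₗ[k] intervalFiber k I q :=
  if h : p ∈ I.carrier ∧ q ∈ I.carrier then
    Submodule.inclusion (show intervalFiber k I p ≤ intervalFiber k I q by
      rw [intervalFiber, intervalFiber, if_pos h.1, if_pos h.2])
  else 0

theorem intervalFiber_eq_zero (I : PosetInterval P) {p : P} (hp : p ∉ I.carrier)
    (x : intervalFiber k I p) : x = 0 := by
  obtain ⟨x, hx⟩ := x
  rw [intervalFiber, if_neg hp] at hx
  exact Subtype.ext hx

/-- The persistence module `k_I` of an interval `I`. -/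
noncomputable def intervalModule (I : PosetInterval P) : PersistenceModule k P where
  obj p := ModuleCat.of k (intervalFiber k I p)
  map {p q} _ := ModuleCat.ofHom (intervalMap k I p q)
  map_id p := by
    ext x
    by_cases hp : p ∈ I.carrier
    · simp [intervalMap, hp]
    · exact congrArg _ ((intervalFiber_eq_zero k I hp _).trans
        (intervalFiber_eq_zero k I hp _).symm)
  map_comp {p q r} f g := by
    ext x
    by_cases hp : p ∈ I.carrier
    · by_cases hr : r ∈ I.carrier
      · have hq : q ∈ I.carrier := I.convex p hp r hr q (leOfHom f) (leOfHom g)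
        simp [intervalMap, hp, hq, hr]
      · exact congrArg _ ((intervalFiber_eq_zero k I hr _).trans
          (intervalFiber_eq_zero k I hr _).symm)
    · have hx : x = 0 := intervalFiber_eq_zero k I hp x
      rw [hx, map_zero, map_zero]

variable {k}

/-- Interval modules: persistence modules isomorphic to `k_I` for some interval `I`. -/
def IsIntervalModule (M : PersistenceModule k P) : Prop :=
  ∃ I : PosetInterval P, Nonempty (M ≅ intervalModule k I)

/-- The family `M` consists of interval modules and `V` is isomorphic to its direct sum (the
coproduct in the category of persistence modules). -/
def IsIntervalDecomposition (V : PersistenceModule k P) {Λ : Type u}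
    (M : Λ → PersistenceModule k P) : Prop :=
  (∀ i, IsIntervalModule (M i)) ∧ Nonempty (V ≅ ∐ M)

end

/-! Existence reduces to splitting a single interval module off every nonzero pointwise
finite-dimensional module. By Zorn's lemma there is a maximal family of split interval submodules
that are mutually orthogonal for their retractions. At each point only finitely many members are
nonzero, so their sum has a complement, the common kernel of the retractions. If the complement were
nonzero it would contain one more summand.

To split off an interval module, choose a centre p₀, a vector v and a functional φ on V(p₀) with
φ(v) = 1. Push v upwards and lift it downwards; pull φ back downwards and extend it upwards.
Extension of φ to p requires that ker(V(p₀) → V(p)) lie in ker φ, lifting of v to p that v lie in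
the image of V(p). To get an interval, v must die wherever φ does not extend, and φ must vanish on
images to which v does not lift. So v and φ must be adapted to the kernels and images at p₀, which
is possible when these form at most two chains (`exists_vector_functional_adapted`). Over the bipath
poset there are never more than two. If V(-∞) → V(+∞) is nonzero, the full poset splits off
directly. Otherwise the centre is -∞ with the kernels along the two branches, or +∞ with the images
along the two branches, or, when both end spaces vanish, a point of a branch with the kernels and
images along that branch.

Uniqueness is a multiplicity count: a composite k_I → k_J → k_I that is nonzero at a point of I
forces I = J, so the matrices comparing the I-parts of two decompositions are mutually inverse
(`Orthogonal.card_fiber_le`). -/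

/-! ### Linear algebra of chains of subspaces and of directed systems -/

section LinearAlgebra

variable {k : Type u} [Field k]

/-- The members of a chain of submodules that meet `F` nontrivially have a common nonzero vector
in `F`. -/
theorem exists_ne_zero_mem_of_isChain {E : Type u} [AddCommGroup E] [Module k E]
    [FiniteDimensional k E] {S : Set (Submodule k E)} (hS : IsChain (· ≤ ·) S)
    (F : Submodule k E) (hF : F ≠ ⊥) :
    ∃ v ∈ F, v ≠ 0 ∧ ∀ K ∈ S, K ⊓ F ≠ ⊥ → v ∈ K := by
  rcases Set.eq_empty_or_nonempty {K ∈ S | K ⊓ F ≠ ⊥} with h | h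
  · obtain ⟨v, hv, hv0⟩ := Submodule.exists_mem_ne_zero_of_ne_bot hF
    refine ⟨v, hv, hv0, fun K hK hKF => ?_⟩
    have : K ∈ {K ∈ S | K ⊓ F ≠ ⊥} := ⟨hK, hKF⟩
    rw [h] at this
    exact this.elim
  -- Finite dimension gives a minimal member meeting `F`; in a chain it is the least one, so any
  -- vector of `K₀ ⊓ F` works.
  · obtain ⟨K₀, ⟨hK₀, hK₀F⟩, hmin⟩ := wellFounded_lt.has_min _ h
    obtain ⟨v, hv, hv0⟩ := Submodule.exists_mem_ne_zero_of_ne_bot hK₀F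
    refine ⟨v, hv.2, hv0, fun K hK hKF => ?_⟩
    rcases hS.total hK₀ hK with h' | h'
    · exact h' hv.1
    · rcases h'.lt_or_eq with h'' | h''
      · exact (hmin K ⟨hK, hKF⟩ h'').elim
      · exact h'' ▸ hv.1

/-- Two chains of submodules of a nonzero finite-dimensional space admit a vector and a functional
that are simultaneously adapted to both chains. -/
theorem exists_vector_functional_adapted {E : Type u} [AddCommGroup E] [Module k E]
    [FiniteDimensional k E] [Nontrivial E] {S T : Set (Submodule k E)}
    (hS : IsChain (· ≤ ·) S) (hT : IsChain (· ≤ ·) T) :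
    ∃ (v : E) (φ : Module.Dual k E), φ v = 1 ∧ (∀ K ∈ S, v ∈ K ∨ K ≤ LinearMap.ker φ) ∧
      (∀ R ∈ T, v ∈ R ∨ R ≤ LinearMap.ker φ) := by
  -- `F` is the least nonzero member of `S`. Any `v ∈ F` is then adapted to `S`, whatever `φ` is, so
  -- `φ` only has to be fitted to `T`.
  obtain ⟨F, hF, hFS⟩ : ∃ F : Submodule k E, F ≠ ⊥ ∧ ∀ K ∈ S, K ≠ ⊥ → F ≤ K := by
    rcases Set.eq_empty_or_nonempty {K ∈ S | K ≠ ⊥} with h | h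
    · refine ⟨⊤, top_ne_bot, fun K hK hK0 => ?_⟩
      have : K ∈ {K ∈ S | K ≠ ⊥} := ⟨hK, hK0⟩
      rw [h] at this
      exact this.elim
    · obtain ⟨K₀, ⟨hK₀, hK₀0⟩, hmin⟩ := wellFounded_lt.has_min _ h
      refine ⟨K₀, hK₀0, fun K hK hK0 => ?_⟩
      rcases hS.total hK₀ hK with h' | h'
      · exact h'
      · rcases h'.lt_or_eq with h'' | h''
        · exact (hmin K ⟨hK, hK0⟩ h'').elim
        · exact h''.ge
  obtain ⟨v, hvF, hv0, hv⟩ := exists_ne_zero_mem_of_isChain hT F hF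
  have hdir : DirectedOn (· ≤ ·) (insert ⊥ {R ∈ T | R ⊓ F = ⊥}) := by
    refine IsChain.directedOn ?_
    exact (hT.mono (Set.sep_subset _ _)).insert fun b _ _ => Or.inl bot_le
  -- The members of `T` that meet `F` trivially are the ones `φ` must kill. They form a chain, so
  -- their supremum is their union and misses `v`; `⊥` is inserted to make the family nonempty.
  have hvR : v ∉ sSup (insert ⊥ {R ∈ T | R ⊓ F = ⊥}) := by
    rw [Submodule.mem_sSup_of_directed (Set.insert_nonempty _ _) hdir]
    rintro ⟨R, rfl | ⟨-, hR⟩, hvR⟩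
    · exact hv0 ((Submodule.mem_bot k).1 hvR)
    · have : v ∈ R ⊓ F := ⟨hvR, hvF⟩
      rw [hR] at this
      exact hv0 ((Submodule.mem_bot k).1 this)
  obtain ⟨φ, hφv, hφ⟩ := Submodule.exists_dual_map_eq_bot_of_notMem hvR inferInstance
  refine ⟨v, (φ v)⁻¹ • φ, by simp [hφv], fun K hK => ?_, fun R hR => ?_⟩
  · by_cases h : K = ⊥
    · exact Or.inr (h ▸ bot_le)
    · exact Or.inl (hFS K hK h hvF)
  · by_cases h : R ⊓ F = ⊥
    · right
      intro x hx
      have hx' : x ∈ sSup (insert ⊥ {R ∈ T | R ⊓ F = ⊥}) :=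
        le_sSup (Set.mem_insert_of_mem (⊥ : Submodule k E)
          (show R ∈ {R ∈ T | R ⊓ F = ⊥} from ⟨hR, h⟩)) hx
      have : φ x ∈ Submodule.map φ (sSup (insert ⊥ {R ∈ T | R ⊓ F = ⊥})) :=
        Submodule.mem_map_of_mem hx'
      rw [hφ] at this
      simp [(Submodule.mem_bot k).1 this]
    · exact Or.inl (hv R hR h)

/-- A functional on one member of a directed system which vanishes on the kernels of all
transition maps extends to a compatible family of functionals. -/
theorem exists_compatible_functionals {ι : Type} [Preorder ι] [IsDirectedOrder ι]
    {G : ι → Type u} [∀ i, AddCommGroup (G i)] [∀ i, Module k (G i)]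
    (f : ∀ i j, i ≤ j → G i →ₗ[k] G j) [DirectedSystem G fun i j h => f i j h]
    (i₀ : ι) (φ : Module.Dual k (G i₀))
    (hφ : ∀ j (h : i₀ ≤ j), LinearMap.ker (f i₀ j h) ≤ LinearMap.ker φ) :
    ∃ ψ : ∀ i, Module.Dual k (G i), ψ i₀ = φ ∧ ∀ i j (h : i ≤ j), ψ j ∘ₗ f i j h = ψ i := by
  classical
  have : Nonempty ι := ⟨i₀⟩
  -- The kernel of `G i₀ → lim G` is the union of the transition kernels, so `φ` factors through the
  -- image and extends to the whole direct limit.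
  have hmem : φ ∈ LinearMap.range (Module.DirectLimit.of k ι G f i₀).dualMap := by
    rw [LinearMap.range_dualMap_eq_dualAnnihilator_ker, Submodule.mem_dualAnnihilator]
    intro x hx
    obtain ⟨j, hj, hx⟩ := Module.DirectLimit.of.zero_exact (LinearMap.mem_ker.1 hx)
    exact hφ j hj hx
  obtain ⟨Ψ, hΨ⟩ := hmem
  refine ⟨fun i => Ψ ∘ₗ Module.DirectLimit.of k ι G f i, hΨ, fun i j h => ?_⟩
  ext x
  simp [Module.DirectLimit.of_f]

end LinearAlgebra

/-! ### Compatible functionals and vectors along a chain -/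

section Transition

variable {k : Type u} [Field k] {P : Type} [PartialOrder P]

/-- The structure map of a persistence module as a linear map. -/
def transition (V : PersistenceModule k P) {p q : P} (h : p ≤ q) : V.obj p →ₗ[k] V.obj q :=
  (V.map (homOfLE h)).hom

variable (V : PersistenceModule k P)

theorem transition_refl {p : P} (h : p ≤ p) (x : V.obj p) : transition V h x = x := by
  simp [transition]

theorem transition_trans {p q r : P} (h : p ≤ q) (h' : q ≤ r) (x : V.obj p) :
    transition V h' (transition V h x) = transition V (h.trans h') x := by
  have : V.map (homOfLE (h.trans h')) = V.map (homOfLE h) ≫ V.map (homOfLE h') := by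
    rw [← V.map_comp]; rfl
  simp [transition, this]

theorem app_transition {V W : PersistenceModule k P} (f : V ⟶ W) {p q : P} (h : p ≤ q)
    (x : V.obj p) : (f.app q).hom (transition V h x) = transition W h ((f.app p).hom x) :=
  congrArg (fun g => g.hom x) (f.naturality (homOfLE h))

/-- A chain is directed, so this is an instance of extension to a direct limit. The value 0 outside
`T` carries no information. -/
theorem exists_functionals_of_isChain {T : Set P} (hT : IsChain (· ≤ ·) T) {p₀ : P} (h₀ : p₀ ∈ T)
    (φ : Module.Dual k (V.obj p₀))
    (hφ : ∀ p ∈ T, ∀ h : p₀ ≤ p, LinearMap.ker (transition V h) ≤ LinearMap.ker φ) :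
    ∃ ψ : ∀ p, Module.Dual k (V.obj p), ψ p₀ = φ ∧
      ∀ p ∈ T, ∀ q ∈ T, ∀ (h : p ≤ q) (x : V.obj p), ψ q (transition V h x) = ψ p x := by
  classical
  have : IsDirectedOrder T := ⟨fun a b => by
    rcases hT.total a.2 b.2 with h | h
    · exact ⟨b, h, le_rfl⟩
    · exact ⟨a, le_rfl, h⟩⟩
  have : DirectedSystem (fun p : T => V.obj p) fun i j (h : i ≤ j) =>
      (transition V h : V.obj i →ₗ[k] V.obj j) :=
    ⟨fun i x => transition_refl V _ x, fun i j l h h' x => transition_trans V _ _ x⟩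
  obtain ⟨ψ, hψ₀, hψ⟩ := exists_compatible_functionals (k := k)
    (G := fun p : T => V.obj p) (fun i j h => transition V h) ⟨p₀, h₀⟩ φ
    (fun j h => hφ j j.2 h)
  refine ⟨fun p => if hp : p ∈ T then ψ ⟨p, hp⟩ else 0, by simpa [h₀] using hψ₀,
    fun p hp q hq h x => ?_⟩
  simp only [hp, hq, dif_pos]
  exact LinearMap.congr_fun (hψ ⟨p, hp⟩ ⟨q, hq⟩ h) x

/-- Lifting `v` to each point separately does not give compatible lifts. By finite-dimensionality
vectors are functionals on the dual spaces, which form a directed system over the reversed chain, so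
functional extension applies. -/
theorem exists_vectors_of_isChain (hV : IsPfd V) {T : Set P} (hT : IsChain (· ≤ ·) T) {p₀ : P}
    (h₀ : p₀ ∈ T) (v : V.obj p₀)
    (hv : ∀ p ∈ T, ∀ h : p ≤ p₀, v ∈ LinearMap.range (transition V h)) :
    ∃ w : ∀ p, V.obj p, w p₀ = v ∧
      ∀ p ∈ T, ∀ q ∈ T, ∀ h : p ≤ q, transition V h (w p) = w q := by
  classical
  have (p : P) : FiniteDimensional k (V.obj p) := hV p
  have : IsDirectedOrder (T)ᵒᵈ := ⟨fun a b => by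
    rcases hT.total a.ofDual.2 b.ofDual.2 with h | h
    · exact ⟨a, le_rfl, h⟩
    · exact ⟨b, h, le_rfl⟩⟩
  have : DirectedSystem (fun p : (T)ᵒᵈ => Module.Dual k (V.obj p.ofDual)) fun i j (h : i ≤ j) =>
      ((transition V (p := j.ofDual) (q := i.ofDual) h).dualMap) :=
    ⟨fun i x => LinearMap.ext fun y => congrArg x (transition_refl V _ y),
      fun i j l h h' x => LinearMap.ext fun y => congrArg x (transition_trans V _ _ y)⟩
  obtain ⟨ψ, hψ₀, hψ⟩ := exists_compatible_functionals (k := k)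
    (G := fun p : (T)ᵒᵈ => Module.Dual k (V.obj p.ofDual))
    (fun i j h => (transition V (p := j.ofDual) (q := i.ofDual) h).dualMap)
    (OrderDual.toDual ⟨p₀, h₀⟩) (Module.Dual.eval k _ v) (by
      -- If `χ` vanishes on the image of `V.obj j` then `χ v = 0`, because `v` lies in that image.
      intro j h χ hχ
      obtain ⟨y, hy⟩ := hv j.ofDual j.ofDual.2 h
      subst hy
      exact LinearMap.congr_fun (LinearMap.mem_ker.1 hχ) y)
  refine ⟨fun p => if hp : p ∈ T then
    (Module.evalEquiv k (V.obj p)).symm (ψ (OrderDual.toDual ⟨p, hp⟩)) else 0, ?_,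
    fun p hp q hq h => ?_⟩
  · simp only [h₀, dif_pos]
    rw [hψ₀]
    exact (Module.evalEquiv k (V.obj p₀)).symm_apply_apply v
  · simp only [hp, hq, dif_pos]
    have key (r : P) (hr : r ∈ T) (χ : Module.Dual k (V.obj r)) :
        χ ((Module.evalEquiv k (V.obj r)).symm (ψ (OrderDual.toDual ⟨r, hr⟩))) =
          ψ (OrderDual.toDual ⟨r, hr⟩) χ :=
      LinearMap.congr_fun ((Module.evalEquiv k (V.obj r)).apply_symm_apply _) χ
    refine Module.eval_apply_injective k (LinearMap.ext fun χ => ?_)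
    exact (key p hp ((transition V h).dualMap χ)).trans ((LinearMap.congr_fun
      (hψ (OrderDual.toDual ⟨q, hq⟩) (OrderDual.toDual ⟨p, hp⟩) h) χ).trans (key q hq χ).symm)

end Transition

/-! ### Split interval submodules and their locally finite sums -/

section IntervalSummand

variable {k : Type u} [Field k] {P : Type} [PartialOrder P]

theorem PosetInterval.ext_carrier {I J : PosetInterval P} (h : I.carrier = J.carrier) : I = J := by
  cases I
  cases J
  cases h
  rfl

/-- A function which takes equal values at comparable points is constant on intervals. -/
theorem PosetInterval.eq_of_forall_le {α : Type*} (I : PosetInterval P) (c : P → α)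
    (hc : ∀ p ∈ I.carrier, ∀ q ∈ I.carrier, p ≤ q → c p = c q)
    {p q : P} (hp : p ∈ I.carrier) (hq : q ∈ I.carrier) : c p = c q := by
  induction I.connected p hp q hq with
  | refl => rfl
  | tail _ h ih =>
    obtain ⟨hx, hy, h | h⟩ := h
    · exact (ih hx).trans (hc _ hx _ hy h)
    · exact (ih hx).trans (hc _ hy _ hx h).symm

/-- The coordinate of an element of `k_I`. -/
noncomputable def intervalCoord (I : PosetInterval P) (p : P) :
    (intervalModule k I).obj p →ₗ[k] k :=
  (intervalFiber k I p).subtype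

open Classical in
/-- The element `1` of the fibre of `k_I` at a point of `I`, and `0` at the other points. -/
noncomputable def intervalOne (I : PosetInterval P) (p : P) : (intervalModule k I).obj p :=
  (⟨if p ∈ I.carrier then 1 else 0, by
    by_cases h : p ∈ I.carrier
    · rw [intervalFiber, if_pos h]
      trivial
    · rw [if_neg h]
      exact Submodule.zero_mem _⟩ : intervalFiber k I p)

theorem intervalModule_eq_zero {I : PosetInterval P} {p : P} (hp : p ∉ I.carrier)
    (x : (intervalModule k I).obj p) : x = 0 :=
  intervalFiber_eq_zero k I hp x

theorem intervalCoord_injective (I : PosetInterval P) (p : P) :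
    Function.Injective (intervalCoord (k := k) I p) :=
  Subtype.val_injective

theorem intervalCoord_eq_zero {I : PosetInterval P} {p : P} (hp : p ∉ I.carrier) :
    intervalCoord (k := k) I p = 0 := by
  ext x
  rw [intervalModule_eq_zero hp x, map_zero, map_zero]

theorem intervalCoord_intervalOne {I : PosetInterval P} {p : P} (hp : p ∈ I.carrier) :
    intervalCoord I p (intervalOne (k := k) I p) = 1 := by
  classical
  exact if_pos hp

theorem intervalCoord_smul_intervalOne {I : PosetInterval P} {p : P}
    (x : (intervalModule k I).obj p) :
    intervalCoord I p x • intervalOne (k := k) I p = x := by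
  by_cases hp : p ∈ I.carrier
  · apply intervalCoord_injective
    rw [map_smul, intervalCoord_intervalOne hp, smul_eq_mul, mul_one]
  · exact (intervalModule_eq_zero hp _).trans (intervalModule_eq_zero hp _).symm

theorem intervalCoord_transition (I : PosetInterval P) {p q : P} (h : p ≤ q)
    (hq : q ∈ I.carrier) (x : (intervalModule k I).obj p) :
    intervalCoord I q (transition (intervalModule k I) h x) = intervalCoord I p x := by
  by_cases hp : p ∈ I.carrier
  · change ((intervalMap k I p q x : intervalFiber k I q) : k) = intervalCoord I p x
    simp only [intervalMap, hp, hq, and_self, dif_pos]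
    rfl
  · rw [intervalModule_eq_zero hp x, map_zero, map_zero, map_zero]

theorem transition_intervalOne (I : PosetInterval P) {p q : P} (h : p ≤ q)
    (hp : p ∈ I.carrier) :
    transition (intervalModule k I) h (intervalOne I p) = intervalOne (k := k) I q := by
  by_cases hq : q ∈ I.carrier
  · apply intervalCoord_injective
    rw [intervalCoord_transition I h hq, intervalCoord_intervalOne hp,
      intervalCoord_intervalOne hq]
  · exact (intervalModule_eq_zero hq _).trans (intervalModule_eq_zero hq _).symm

/-- A split embedding of an interval module into `V`, given by the images `v p` of the
generators and by the coordinates `φ p` of the retraction. -/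
structure IntervalSummand (V : PersistenceModule k P) where
  I : PosetInterval P
  v : ∀ p, V.obj p
  φ : ∀ p, Module.Dual k (V.obj p)
  transition_v : ∀ {p q : P} (h : p ≤ q), p ∈ I.carrier → transition V h (v p) = v q
  φ_transition : ∀ {p q : P} (h : p ≤ q), q ∈ I.carrier →
    ∀ x, φ q (transition V h x) = φ p x
  v_eq_zero : ∀ {p : P}, p ∉ I.carrier → v p = 0
  φ_eq_zero : ∀ {p : P}, p ∉ I.carrier → φ p = 0
  φ_v : ∀ {p : P}, p ∈ I.carrier → φ p (v p) = 1

namespace IntervalSummand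

variable {V : PersistenceModule k P}

/-- The inclusion of the interval module. -/
noncomputable def incl (s : IntervalSummand V) : intervalModule k s.I ⟶ V where
  app p := ModuleCat.ofHom
    ((LinearMap.toSpanSingleton k (V.obj p) (s.v p)).comp (intervalCoord s.I p))
  naturality p q f := by
    ext x
    change intervalCoord s.I q (transition (intervalModule k s.I) (leOfHom f) x) • s.v q =
      transition V (leOfHom f) (intervalCoord s.I p x • s.v p)
    rw [map_smul]
    by_cases hp : p ∈ s.I.carrier
    · rw [s.transition_v _ hp]
      by_cases hq : q ∈ s.I.carrier
      · rw [intervalCoord_transition s.I _ hq]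
      · rw [s.v_eq_zero hq, smul_zero, smul_zero]
    · rw [intervalModule_eq_zero hp x, map_zero, map_zero, map_zero, zero_smul, zero_smul]

theorem incl_app (s : IntervalSummand V) (p : P) (x : (intervalModule k s.I).obj p) :
    (s.incl.app p).hom x = intervalCoord s.I p x • s.v p := rfl

/-- The retraction onto the interval module. -/
noncomputable def proj (s : IntervalSummand V) : V ⟶ intervalModule k s.I where
  app p := ModuleCat.ofHom
    ((LinearMap.toSpanSingleton k ((intervalModule k s.I).obj p) (intervalOne s.I p)).comp (s.φ p))
  naturality p q f := by
    ext x
    change s.φ q (transition V (leOfHom f) x) • intervalOne s.I q =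
      transition (intervalModule k s.I) (leOfHom f) (s.φ p x • intervalOne s.I p)
    by_cases hq : q ∈ s.I.carrier
    · rw [s.φ_transition (leOfHom f) hq, map_smul]
      by_cases hp : p ∈ s.I.carrier
      · rw [transition_intervalOne s.I _ hp]
      · simp [s.φ_eq_zero hp]
    · exact (intervalModule_eq_zero hq _).trans (intervalModule_eq_zero hq _).symm

theorem proj_app (s : IntervalSummand V) (p : P) (x : V.obj p) :
    (s.proj.app p).hom x = s.φ p x • intervalOne (k := k) s.I p := rfl

theorem proj_comp_incl_app (s : IntervalSummand V) (p : P) (x : V.obj p) :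
    ((s.proj ≫ s.incl).app p).hom x = s.φ p x • s.v p := by
  change (s.incl.app p).hom ((s.proj.app p).hom x) = _
  rw [incl_app, proj_app, map_smul]
  by_cases hp : p ∈ s.I.carrier
  · rw [intervalCoord_intervalOne hp, smul_eq_mul, mul_one]
  · rw [s.v_eq_zero hp, smul_zero, smul_zero]

variable {Λ : Type u} (s : Λ → IntervalSummand V)

/-- The summands of the family are in direct sum position, compatibly with the retractions. -/
def Orthogonal : Prop := ∀ i j, i ≠ j → ∀ p, (s j).φ p ((s i).v p) = 0

variable {s}

theorem Orthogonal.linearIndependent (hs : Orthogonal s) (p : P) :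
    LinearIndependent k fun i : {i // p ∈ (s i).I.carrier} => (s i).v p :=
  LinearIndependent.of_pairwise_dual_eq_zero_one _ (fun i => (s i).φ p)
    (fun i j hij => hs j i (fun h => hij (Subtype.ext h.symm)) p) fun i => (s i).φ_v i.2

/-- Pointwise finiteness enters here: it makes infinite families of summands summable at each point.
-/
theorem Orthogonal.finite (hs : Orthogonal s) (hV : IsPfd V) (p : P) :
    {i | p ∈ (s i).I.carrier}.Finite := by
  have := hV p
  exact (hs.linearIndependent p).finite_of_isNoetherian

variable {W : PersistenceModule k P}

/-- The finite index set of a locally finite sum depends on the point; enlarging it adds only zeros,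
so sums at two points can be taken over a common set. -/
theorem sum_app_eq_of_subset (h : ∀ i, intervalModule k (s i).I ⟶ W) {p : P}
    {F G : Finset Λ} (hFG : F ⊆ G) (hF : ∀ i, p ∈ (s i).I.carrier → i ∈ F) (x : V.obj p) :
    ∑ i ∈ F, (((s i).proj ≫ h i).app p).hom x = ∑ i ∈ G, (((s i).proj ≫ h i).app p).hom x := by
  refine Finset.sum_subset hFG fun i _ hi => ?_
  have hp : p ∉ (s i).I.carrier := fun hp => hi (hF i hp)
  have : ((s i).proj.app p).hom x = 0 := intervalModule_eq_zero hp _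
  change ((h i).app p).hom (((s i).proj.app p).hom x) = 0
  rw [this, map_zero]

/-- The locally finite sum of morphisms factoring through the members of an orthogonal family. -/
noncomputable def Orthogonal.sumHom (hs : Orthogonal s) (hV : IsPfd V)
    (h : ∀ i, intervalModule k (s i).I ⟶ W) : V ⟶ W where
  app p := ModuleCat.ofHom (∑ i ∈ (hs.finite hV p).toFinset, (((s i).proj ≫ h i).app p).hom)
  naturality p q f := by
    classical
    ext x
    change (∑ i ∈ (hs.finite hV q).toFinset, (((s i).proj ≫ h i).app q).hom)
        (transition V (leOfHom f) x) = transition W (leOfHom f)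
        ((∑ i ∈ (hs.finite hV p).toFinset, (((s i).proj ≫ h i).app p).hom) x)
    rw [LinearMap.sum_apply, LinearMap.sum_apply,
      sum_app_eq_of_subset h (Finset.subset_union_right (s₁ := (hs.finite hV p).toFinset))
        (fun i hi => (Set.Finite.mem_toFinset _).2 hi),
      sum_app_eq_of_subset h (Finset.subset_union_left (s₂ := (hs.finite hV q).toFinset))
        (fun i hi => (Set.Finite.mem_toFinset _).2 hi), map_sum]
    exact Finset.sum_congr rfl fun i _ => app_transition _ _ x

theorem Orthogonal.sumHom_app (hs : Orthogonal s) (hV : IsPfd V)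
    (h : ∀ i, intervalModule k (s i).I ⟶ W) (p : P) (x : V.obj p) :
    ((hs.sumHom hV h).app p).hom x =
      ∑ i ∈ (hs.finite hV p).toFinset, (((s i).proj ≫ h i).app p).hom x :=
  LinearMap.sum_apply _ _ _

theorem Orthogonal.incl_sumHom (hs : Orthogonal s) (hV : IsPfd V)
    (h : ∀ i, intervalModule k (s i).I ⟶ W) (i : Λ) : (s i).incl ≫ hs.sumHom hV h = h i := by
  ext p x
  change ((hs.sumHom hV h).app p).hom (((s i).incl.app p).hom x) = ((h i).app p).hom x
  rw [hs.sumHom_app hV, incl_app]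
  by_cases hp : p ∈ (s i).I.carrier
  · rw [Finset.sum_eq_single i]
    · change ((h i).app p).hom (((s i).proj.app p).hom _) = _
      rw [proj_app, map_smul ((s i).φ p), (s i).φ_v hp, smul_eq_mul, mul_one,
        intervalCoord_smul_intervalOne]
    · intro j _ hj
      change ((h j).app p).hom (((s j).proj.app p).hom _) = _
      rw [proj_app, map_smul ((s j).φ p), hs i j hj.symm, smul_zero, zero_smul, map_zero]
    · intro hi
      exact (hi (by simpa using hp)).elim
  · rw [intervalModule_eq_zero hp x, map_zero, map_zero, zero_smul]
    exact Finset.sum_eq_zero fun j _ => map_zero _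

/-- The sum of the idempotents of the family does not change coordinates. Hence `x` minus its image
lies in the common kernel, which gives both the expansion of `x` in a complete family and the
complement of an incomplete one. -/
theorem Orthogonal.φ_sumHom_incl (hs : Orthogonal s) (hV : IsPfd V) (i : Λ) (p : P)
    (x : V.obj p) :
    (s i).φ p (((hs.sumHom hV fun i => (s i).incl).app p).hom x) = (s i).φ p x := by
  rw [hs.sumHom_app hV, map_sum]
  have key (j : Λ) : (s i).φ p ((((s j).proj ≫ (s j).incl).app p).hom x) =
      (s j).φ p x * (s i).φ p ((s j).v p) := by
    rw [proj_comp_incl_app, map_smul, smul_eq_mul]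
  simp_rw [key]
  by_cases hp : p ∈ (s i).I.carrier
  · rw [Finset.sum_eq_single i]
    · rw [(s i).φ_v hp, mul_one]
    · intro j _ hj
      rw [hs j i hj, mul_zero]
    · intro hi
      exact (hi (by simpa using hp)).elim
  · simp [(s i).φ_eq_zero hp]

/-- No nonzero element is killed by all the retractions. -/
def Complete (s : Λ → IntervalSummand V) : Prop :=
  ∀ p (x : V.obj p), (∀ i, (s i).φ p x = 0) → x = 0

theorem Orthogonal.sum_eq_self (hs : Orthogonal s) (hc : Complete s) (hV : IsPfd V) (p : P)
    (x : V.obj p) : ∑ i ∈ (hs.finite hV p).toFinset, (s i).φ p x • (s i).v p = x := by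
  have h := hs.sumHom_app hV (fun i => (s i).incl) p x
  simp_rw [proj_comp_incl_app] at h
  rw [← h]
  refine sub_eq_zero.1 ?_
  refine hc p _ fun i => ?_
  rw [map_sub, hs.φ_sumHom_incl hV, sub_self]

/-- A persistence module is the direct sum of a complete orthogonal family of summands. -/
theorem Orthogonal.isIntervalDecomposition (hs : Orthogonal s) (hc : Complete s) (hV : IsPfd V) :
    IsIntervalDecomposition V fun i => intervalModule k (s i).I := by
  refine ⟨fun i => ⟨(s i).I, ⟨Iso.refl _⟩⟩, ⟨?_⟩⟩
  refine IsColimit.coconePointUniqueUpToIso (s := Cofan.mk V fun i => (s i).incl)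
    -- `V` itself has the universal property of the coproduct: locally finite sums give the induced
    -- maps, and the expansion of each element gives their uniqueness.
    (Cofan.IsColimit.mk _ (fun t => hs.sumHom hV t.inj) (fun t i => hs.incl_sumHom hV _ i) ?_)
    (colimit.isColimit _)
  intro t m hm
  ext p x
  conv_lhs => rw [← hs.sum_eq_self hc hV p x]
  rw [hs.sumHom_app hV, map_sum]
  refine Finset.sum_congr rfl fun i _ => ?_
  rw [← hm i, ← proj_comp_incl_app]
  rfl

end IntervalSummand
end IntervalSummand

/-! ### Complements and existence by Zorn's lemma -/

section Decomposition

variable {k : Type u} [Field k] {P : Type} [PartialOrder P]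

/-- The persistence submodule on a family of subspaces stable under the structure maps. -/
noncomputable def subPersistence (V : PersistenceModule k P) (W : ∀ p, Submodule k (V.obj p))
    (hW : ∀ {p q : P} (h : p ≤ q), ∀ x ∈ W p, transition V h x ∈ W q) :
    PersistenceModule k P where
  obj p := ModuleCat.of k (W p)
  map f := ModuleCat.ofHom ((transition V (leOfHom f)).restrict (hW (leOfHom f)))
  map_id p := ModuleCat.hom_ext <| LinearMap.ext fun x : W p =>
    Subtype.ext (transition_refl V le_rfl x.1)
  map_comp f g := ModuleCat.hom_ext <| LinearMap.ext fun x : W _ =>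
    Subtype.ext (transition_trans V (leOfHom f) (leOfHom g) x.1).symm

namespace IntervalSummand

variable {V : PersistenceModule k P} {Λ : Type u} {s : Λ → IntervalSummand V}

/-- The common kernel of the retractions of a family of summands. -/
noncomputable def commonKer (s : Λ → IntervalSummand V) : PersistenceModule k P :=
  subPersistence V (fun p => ⨅ i, LinearMap.ker ((s i).φ p)) fun {p q} h x hx => by
    rw [Submodule.mem_iInf] at hx ⊢
    intro i
    by_cases hq : q ∈ (s i).I.carrier
    · rw [LinearMap.mem_ker, (s i).φ_transition h hq]
      exact hx i
    · simp [(s i).φ_eq_zero hq]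

theorem isPfd_commonKer (hV : IsPfd V) (s : Λ → IntervalSummand V) : IsPfd (commonKer s) := by
  intro p
  have := hV p
  exact inferInstanceAs (FiniteDimensional k (⨅ i, LinearMap.ker ((s i).φ p) : Submodule k _))

/-- The inclusion of the common kernel. -/
noncomputable def commonKerIncl (s : Λ → IntervalSummand V) : commonKer s ⟶ V where
  app p := ModuleCat.ofHom (⨅ i, LinearMap.ker ((s i).φ p)).subtype

theorem commonKerIncl_injective (s : Λ → IntervalSummand V) (p : P) :
    Function.Injective ((commonKerIncl s).app p).hom :=
  Subtype.val_injective

theorem φ_commonKerIncl (s : Λ → IntervalSummand V) (i : Λ) (p : P) (x : (commonKer s).obj p) :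
    (s i).φ p (((commonKerIncl s).app p).hom x) = 0 :=
  (Submodule.mem_iInf _).1 (show (⨅ i, LinearMap.ker ((s i).φ p) : Submodule k _) from x).2 i

theorem Orthogonal.sub_sumHom_mem (hs : Orthogonal s) (hV : IsPfd V) (p : P) (x : V.obj p) :
    (LinearMap.id - ((hs.sumHom hV fun i => (s i).incl).app p).hom : V.obj p →ₗ[k] V.obj p) x ∈
      (⨅ i, LinearMap.ker ((s i).φ p) : Submodule k (V.obj p)) := by
  rw [Submodule.mem_iInf]
  intro i
  rw [LinearMap.mem_ker, LinearMap.sub_apply, map_sub, hs.φ_sumHom_incl hV, LinearMap.id_apply,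
    sub_self]

/-- The projection onto the common kernel along an orthogonal family. -/
noncomputable def Orthogonal.commonKerProj (hs : Orthogonal s) (hV : IsPfd V) :
    V ⟶ commonKer s where
  app p := ModuleCat.ofHom ((LinearMap.id -
    ((hs.sumHom hV fun i => (s i).incl).app p).hom).codRestrict
      (⨅ i, LinearMap.ker ((s i).φ p)) (hs.sub_sumHom_mem hV p))
  naturality p q f := by
    ext x
    refine Subtype.ext ?_
    change transition V (leOfHom f) x -
      ((hs.sumHom hV fun i => (s i).incl).app q).hom (transition V (leOfHom f) x) =
      transition V (leOfHom f) (x - ((hs.sumHom hV fun i => (s i).incl).app p).hom x)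
    rw [app_transition, map_sub]

theorem Orthogonal.commonKerIncl_commonKerProj (hs : Orthogonal s) (hV : IsPfd V) (p : P)
    (x : V.obj p) :
    ((commonKerIncl s).app p).hom (((hs.commonKerProj hV).app p).hom x) =
      x - ((hs.sumHom hV fun i => (s i).incl).app p).hom x := rfl

theorem Orthogonal.commonKerProj_commonKerIncl (hs : Orthogonal s) (hV : IsPfd V) (p : P)
    (x : (commonKer s).obj p) :
    ((hs.commonKerProj hV).app p).hom (((commonKerIncl s).app p).hom x) = x := by
  apply commonKerIncl_injective
  rw [hs.commonKerIncl_commonKerProj hV, hs.sumHom_app hV, sub_eq_self]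
  refine Finset.sum_eq_zero fun i _ => ?_
  rw [proj_comp_incl_app, φ_commonKerIncl, zero_smul]

theorem Orthogonal.commonKerProj_v (hs : Orthogonal s) (hV : IsPfd V) (i : Λ) (p : P) :
    ((hs.commonKerProj hV).app p).hom ((s i).v p) = 0 := by
  apply commonKerIncl_injective
  rw [hs.commonKerIncl_commonKerProj hV, map_zero]
  by_cases hp : p ∈ (s i).I.carrier
  · rw [hs.sumHom_app hV, Finset.sum_eq_single i]
    · rw [proj_comp_incl_app, (s i).φ_v hp, one_smul, sub_self]
    · intro j _ hj
      rw [proj_comp_incl_app, hs i j hj.symm, zero_smul]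
    · intro hi
      exact (hi ((Set.Finite.mem_toFinset _).2 hp)).elim
  · rw [(s i).v_eq_zero hp, map_zero, sub_zero]

/-- Transport of a summand along a retract. -/
noncomputable def ofRetract {W : PersistenceModule k P} (t : IntervalSummand W) (f : W ⟶ V)
    (g : V ⟶ W) (hfg : ∀ p x, (g.app p).hom ((f.app p).hom x) = x) : IntervalSummand V where
  I := t.I
  v p := (f.app p).hom (t.v p)
  φ p := t.φ p ∘ₗ (g.app p).hom
  transition_v h hp := by rw [← app_transition, t.transition_v h hp]
  φ_transition h hq x := by
    rw [LinearMap.comp_apply, app_transition, t.φ_transition h hq]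
    rfl
  v_eq_zero hp := by rw [t.v_eq_zero hp, map_zero]
  φ_eq_zero hp := by rw [t.φ_eq_zero hp, LinearMap.zero_comp]
  φ_v hp := by rw [LinearMap.comp_apply, hfg, t.φ_v hp]

theorem ne_of_φ_v_eq_zero {s t : IntervalSummand V} (h : ∀ p, s.φ p (t.v p) = 0) : s ≠ t := by
  rintro rfl
  obtain ⟨p, hp⟩ := s.I.nonempty
  exact one_ne_zero ((s.φ_v hp).symm.trans (h p))

/-- If all nonzero pointwise finite-dimensional modules have an interval summand, then they all
have a complete orthogonal family of interval summands. -/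
theorem exists_orthogonal_complete
    (H : ∀ W : PersistenceModule k P, IsPfd W → (∃ p, Nontrivial (W.obj p)) →
      Nonempty (IntervalSummand W)) (hV : IsPfd V) :
    ∃ (Λ : Type u) (s : Λ → IntervalSummand V), Orthogonal s ∧ Complete s := by
  obtain ⟨S, hS⟩ := zorn_subset
    {S : Set (IntervalSummand V) | Orthogonal fun i : S => (i : IntervalSummand V)} (by
    intro c hc hchain
    refine ⟨⋃₀ c, ?_, fun s hs => Set.subset_sUnion_of_mem hs⟩
    rintro ⟨i, A, hA, hi⟩ ⟨j, B, hB, hj⟩ hij p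
    have hij' : i ≠ j := fun h => hij (Subtype.ext h)
    rcases hchain.total hA hB with h | h
    · exact hc hB ⟨i, h hi⟩ ⟨j, hj⟩ (fun h => hij' (congrArg Subtype.val h)) p
    · exact hc hA ⟨i, hi⟩ ⟨j, h hj⟩ (fun h => hij' (congrArg Subtype.val h)) p)
  have hs : Orthogonal fun i : S => (i : IntervalSummand V) := hS.prop
  refine ⟨S, fun i => i, hs, fun p x hx => ?_⟩
  by_contra hx0
  obtain ⟨t⟩ := H (commonKer fun i : S => (i : IntervalSummand V)) (isPfd_commonKer hV _)
    ⟨p, ⟨⟨⟨x, (Submodule.mem_iInf _).2 hx⟩, 0, fun h => hx0 (congrArg Subtype.val h)⟩⟩⟩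
  let t' : IntervalSummand V := t.ofRetract (commonKerIncl _) (hs.commonKerProj hV)
    (hs.commonKerProj_commonKerIncl hV)
  have h₁ (i : S) (p : P) : (i : IntervalSummand V).φ p (t'.v p) = 0 :=
    φ_commonKerIncl (fun i : S => (i : IntervalSummand V)) i p _
  have h₂ (i : S) (p : P) : t'.φ p ((i : IntervalSummand V).v p) = 0 := by
    change t.φ p (((hs.commonKerProj hV).app p).hom ((i : IntervalSummand V).v p)) = 0
    rw [hs.commonKerProj_v hV i p, map_zero]
  have hins : insert t' S ∈
      {S : Set (IntervalSummand V) | Orthogonal fun i : S => (i : IntervalSummand V)} := by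
    rintro ⟨i, hi⟩ ⟨j, hj⟩ hij p
    rcases hi with rfl | hi <;> rcases hj with rfl | hj
    · exact (hij rfl).elim
    · exact h₁ ⟨j, hj⟩ p
    · exact h₂ ⟨i, hi⟩ p
    · exact hs ⟨i, hi⟩ ⟨j, hj⟩ (fun h => hij (Subtype.ext (Subtype.mk.inj h))) p
  -- Maximality puts `t'` in `S`, yet every member of `S` kills the vectors of `t'`, so `t'` would
  -- kill its own.
  have hmem : t' ∈ S := hS.le_of_ge hins (Set.subset_insert _ _) (Set.mem_insert _ _)
  exact ne_of_φ_v_eq_zero (h₁ ⟨t', hmem⟩) rfl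

/-! ### Uniqueness of multiplicities -/

/-- The endomorphism through an interval module shared by two summands. -/
noncomputable def link (s s' : IntervalSummand V) (hI : s.I = s'.I) : V ⟶ V where
  app p := ModuleCat.ofHom ((LinearMap.toSpanSingleton k (V.obj p) (s.v p)).comp (s'.φ p))
  naturality p q f := by
    ext x
    change s'.φ q (transition V (leOfHom f) x) • s.v q =
      transition V (leOfHom f) (s'.φ p x • s.v p)
    rw [map_smul]
    by_cases hq : q ∈ s.I.carrier
    · rw [s'.φ_transition _ (hI ▸ hq)]
      by_cases hp : p ∈ s.I.carrier
      · rw [s.transition_v _ hp]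
      · have hp' : p ∉ s'.I.carrier := hI ▸ hp
        rw [s'.φ_eq_zero hp', LinearMap.zero_apply, zero_smul, zero_smul]
    · by_cases hp : p ∈ s.I.carrier
      · rw [s.transition_v _ hp, s.v_eq_zero hq, smul_zero, smul_zero]
      · rw [s.v_eq_zero hq, s.v_eq_zero hp, map_zero, smul_zero, smul_zero]

/-- The composite k_I → V → V → k_I is a single scalar because `I` is connected. -/
theorem φ_app_v_eq (s s' : IntervalSummand V) (hI : s.I = s'.I) (E : V ⟶ V) {p q : P}
    (hp : p ∈ s.I.carrier) (hq : q ∈ s.I.carrier) :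
    s'.φ p ((E.app p).hom (s.v p)) = s'.φ q ((E.app q).hom (s.v q)) := by
  refine s.I.eq_of_forall_le (fun p => s'.φ p ((E.app p).hom (s.v p))) ?_ hp hq
  intro p hp q hq h
  rw [← s.transition_v h hp, app_transition, s'.φ_transition h (hI ▸ hq)]

/-- An interval module is a retract of another one only if the intervals agree. -/
theorem interval_eq_of_mul_ne_zero (s s' t : IntervalSummand V) (hI : s.I = s'.I) {p : P}
    (hp : p ∈ s.I.carrier) (hne : t.φ p (s.v p) * s'.φ p (t.v p) ≠ 0) : t.I = s.I := by
  have hpt : p ∈ t.I.carrier := by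
    by_contra h
    simp [t.v_eq_zero h] at hne
  refine PosetInterval.ext_carrier (Set.Subset.antisymm (fun q hq => ?_) fun q hq => ?_)
  · by_contra h
    -- The product in `hne` is the scalar of the loop at `t` through `k_I`; at a point of `t.I`
    -- outside `s.I` it would be 0. The other inclusion uses the loop at `I` through `t`.
    have := φ_app_v_eq t t rfl (link s s' hI) hpt hq
    change t.φ p (s'.φ p (t.v p) • s.v p) = t.φ q (s'.φ q (t.v q) • s.v q) at this
    rw [s.v_eq_zero h, smul_zero, map_zero, map_smul, smul_eq_mul, mul_comm] at this
    exact hne this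
  · by_contra h
    have := φ_app_v_eq s s' hI (t.proj ≫ t.incl) hp hq
    rw [proj_comp_incl_app, proj_comp_incl_app, t.v_eq_zero h, smul_zero, map_zero, map_smul,
      smul_eq_mul] at this
    exact hne this

variable {Γ : Type u} {t : Γ → IntervalSummand V}

theorem Orthogonal.finite_fiber (hs : Orthogonal s) (hV : IsPfd V) (I : PosetInterval P) :
    Finite {i // (s i).I = I} := by
  obtain ⟨p, hp⟩ := I.nonempty
  exact ((hs.finite hV p).subset fun i (hi : (s i).I = I) => show p ∈ (s i).I.carrier from
    hi ▸ hp).to_subtype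

/-- At one point of `I`, the matrices of coordinates of `s` in `t` and of `t` in `s`, restricted to
summands with interval `I`, multiply to the identity. So the rows of the first are independent and
no more numerous than its columns. -/
theorem Orthogonal.card_fiber_le (hs : Orthogonal s) (ht : Orthogonal t) (hc : Complete t)
    (hV : IsPfd V) (I : PosetInterval P) :
    Nat.card {i // (s i).I = I} ≤ Nat.card {j // (t j).I = I} := by
  classical
  have := hs.finite_fiber hV I
  have := ht.finite_fiber hV I
  have := Fintype.ofFinite {i // (s i).I = I}
  have := Fintype.ofFinite {j // (t j).I = I}
  obtain ⟨p, hp⟩ := I.nonempty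
  have key (i i' : {i // (s i).I = I}) :
      ∑ j : {j // (t j).I = I}, (t j).φ p ((s i).v p) * (s i').φ p ((t j).v p) =
        (s i').φ p ((s i).v p) := by
    have hsum := congrArg ((s i').φ p) (ht.sum_eq_self hc hV p ((s i).v p))
    simp only [map_sum, map_smul, smul_eq_mul] at hsum
    rw [← hsum, ← Finset.sum_subtype ((ht.finite hV p).toFinset.filter fun j => (t j).I = I)
      (p := fun j => (t j).I = I) (f := fun j => (t j).φ p ((s i).v p) * (s i').φ p ((t j).v p))]
    -- In the full expansion over `t`, terms whose interval differs from `I` vanish.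
    · refine Finset.sum_subset (Finset.filter_subset _ _) fun j hj hj' => ?_
      by_contra hne
      refine hj' (Finset.mem_filter.2 ⟨hj, ?_⟩)
      exact (interval_eq_of_mul_ne_zero (s i) (s i') (t j) (i.2.trans i'.2.symm)
        (i.2.symm ▸ hp) hne).trans i.2
    · intro j
      rw [Finset.mem_filter, Set.Finite.mem_toFinset]
      exact ⟨fun h => h.2, fun h => ⟨show p ∈ (t j).I.carrier from h.symm ▸ hp, h⟩⟩
  have hLI : LinearIndependent k fun (i : {i // (s i).I = I}) (j : {j // (t j).I = I}) =>
      (t j).φ p ((s i).v p) := by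
    refine LinearIndependent.of_pairwise_dual_eq_zero_one _
      (fun i' => ∑ j, (s i').φ p ((t j.1).v p) • LinearMap.proj j) ?_ ?_
    · intro i' i hne
      simp only [LinearMap.sum_apply, LinearMap.smul_apply, LinearMap.proj_apply, smul_eq_mul]
      simp_rw [mul_comm ((s i').φ p _)]
      rw [key]
      exact hs i i' (fun h => hne (Subtype.ext h.symm)) p
    · intro i
      simp only [LinearMap.sum_apply, LinearMap.smul_apply, LinearMap.proj_apply, smul_eq_mul]
      simp_rw [mul_comm ((s i).φ p _)]
      rw [key]
      exact (s i).φ_v (i.2.symm ▸ hp)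
  simpa [Nat.card_eq_fintype_card] using hLI.fintype_card_le_finrank

/-- Two complete orthogonal families contain each interval equally often. -/
theorem exists_equiv (hs : Orthogonal s) (hsc : Complete s) (ht : Orthogonal t) (htc : Complete t)
    (hV : IsPfd V) : ∃ σ : Λ ≃ Γ, ∀ i, (t (σ i)).I = (s i).I := by
  have (I : PosetInterval P) : Nonempty ({i // (s i).I = I} ≃ {j // (t j).I = I}) := by
    have := hs.finite_fiber hV I
    have := ht.finite_fiber hV I
    exact (Finite.card_eq).1
      (le_antisymm (hs.card_fiber_le ht htc hV I) (ht.card_fiber_le hs hsc hV I))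
  exact ⟨Equiv.ofFiberEquiv (f := fun i => (s i).I) (g := fun j => (t j).I) fun I => (this I).some,
    fun i => Equiv.ofFiberEquiv_map (f := fun i => (s i).I) (g := fun j => (t j).I) _ i⟩

/-! ### From coproduct decompositions to orthogonal complete families -/

/-- The summand given by an interval module that is a retract of `V`. -/
noncomputable def ofHoms (I : PosetInterval P) (f : intervalModule k I ⟶ V)
    (g : V ⟶ intervalModule k I) (hfg : f ≫ g = 𝟙 _) : IntervalSummand V where
  I := I
  v p := (f.app p).hom (intervalOne I p)
  φ p := intervalCoord I p ∘ₗ (g.app p).hom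
  transition_v h hp := by rw [← app_transition, transition_intervalOne I h hp]
  φ_transition h hq x := by
    rw [LinearMap.comp_apply, app_transition, intervalCoord_transition I h hq]
    rfl
  v_eq_zero hp := by rw [intervalModule_eq_zero hp (intervalOne I _), map_zero]
  φ_eq_zero hp := by rw [intervalCoord_eq_zero hp, LinearMap.zero_comp]
  φ_v {p} hp := by
    have : (g.app p).hom ((f.app p).hom (intervalOne I p)) = intervalOne I p :=
      congrArg (fun h => (h.app p).hom (intervalOne I p)) hfg
    rw [LinearMap.comp_apply, this, intervalCoord_intervalOne hp]

end IntervalSummand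

/-- The value of a coproduct of persistence modules is spanned by the summands. -/
theorem iSup_range_sigma_ι {Λ : Type u} (M : Λ → PersistenceModule k P) (p : P) :
    ⨆ i, LinearMap.range ((Sigma.ι M i).app p).hom = ⊤ := by
  let W : Submodule k ((∐ M).obj p) := ⨆ i, LinearMap.range ((Sigma.ι M i).app p).hom
  have hc := isColimitOfPreserves ((evaluation P (ModuleCat.{u} k)).obj p)
    (colimit.isColimit (Discrete.functor M))
  -- Evaluation at `p` preserves the coproduct, so the quotient map by `W` is determined on the
  -- summands, where it is zero.
  have h0 : ModuleCat.ofHom W.mkQ = (0 : (∐ M).obj p ⟶ ModuleCat.of k (_ ⧸ W)) := by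
    refine hc.hom_ext ?_
    rintro ⟨i⟩
    ext x
    exact (Submodule.Quotient.mk_eq_zero W).2
      (Submodule.mem_iSup_of_mem i (LinearMap.mem_range_self ((Sigma.ι M i).app p).hom x))
  refine eq_top_iff.2 fun x _ => ?_
  exact (Submodule.Quotient.mk_eq_zero W).1 (congrArg (fun f => f.hom x) h0)

-- The coproduct inclusions and the projections `Sigma.π` supply the split embeddings. Completeness
-- holds because an element of a coproduct is a finite sum of components, each recovered from its
-- projection.
open IntervalSummand in
theorem IsIntervalDecomposition.exists_orthogonal_complete {V : PersistenceModule k P}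
    {Λ : Type u} {M : Λ → PersistenceModule k P} (h : IsIntervalDecomposition V M) :
    ∃ s : Λ → IntervalSummand V, Orthogonal s ∧ Complete s ∧
      ∀ i, Nonempty (M i ≅ intervalModule k (s i).I) := by
  classical
  obtain ⟨hM, ⟨e⟩⟩ := h
  choose I hI using hM
  let a (i : Λ) : M i ≅ intervalModule k (I i) := (hI i).some
  let s (i : Λ) : IntervalSummand V := ofHoms (I i) ((a i).inv ≫ Sigma.ι M i ≫ e.inv)
    (e.hom ≫ Sigma.π M i ≫ (a i).hom) (by simp)
  refine ⟨s, fun i j hij p => ?_, fun p x hx => ?_, hI⟩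
  · have : ((a i).inv ≫ Sigma.ι M i ≫ e.inv) ≫ (e.hom ≫ Sigma.π M j ≫ (a j).hom) = 0 := by
      simp only [Category.assoc, Iso.inv_hom_id_assoc]
      rw [Sigma.ι_π_of_ne_assoc M hij, zero_comp, comp_zero]
    have := congrArg (fun h => intervalCoord (I j) p ((h.app p).hom (intervalOne (I i) p))) this
    exact this.trans (map_zero _)
  · have hπ (i : Λ) : ((Sigma.π M i).app p).hom ((e.hom.app p).hom x) = 0 := by
      have h1 : ((a i).hom.app p).hom (((Sigma.π M i).app p).hom ((e.hom.app p).hom x)) = 0 :=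
        intervalCoord_injective _ _ ((hx i).trans (map_zero _).symm)
      have h2 := congrArg (fun y => ((a i).inv.app p).hom y) h1
      have h3 := congrArg (fun h => (h.app p).hom
        (((Sigma.π M i).app p).hom ((e.hom.app p).hom x))) (a i).hom_inv_id
      exact h3.symm.trans (h2.trans (map_zero _))
    have hmem : (e.hom.app p).hom x ∈ ⨆ i, LinearMap.range ((Sigma.ι M i).app p).hom := by
      rw [iSup_range_sigma_ι]
      trivial
    obtain ⟨f, hf, hsum⟩ := (Submodule.mem_iSup_iff_exists_finsupp _ _).1 hmem
    have hzero : (e.hom.app p).hom x = 0 := by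
      rw [← hsum]
      refine Finset.sum_eq_zero fun i _ => ?_
      have hproj (j : Λ) (y) (hy : y ∈ LinearMap.range ((Sigma.ι M j).app p).hom) :
          ((Sigma.π M i ≫ Sigma.ι M i).app p).hom y = if j = i then y else 0 := by
        obtain ⟨y, rfl⟩ := hy
        have h : Sigma.ι M j ≫ Sigma.π M i ≫ Sigma.ι M i =
            if j = i then Sigma.ι M j else 0 := by
          split_ifs with hji
          · subst hji
            rw [Sigma.ι_π_eq_id_assoc]
          · rw [Sigma.ι_π_of_ne_assoc M hji, zero_comp]
        have := congrArg (fun h => (h.app p).hom y) h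
        split_ifs at this ⊢ <;> exact this
      have h1 : ((Sigma.π M i ≫ Sigma.ι M i).app p).hom (f.sum fun _ y => y) = 0 := by
        rw [hsum]
        exact (congrArg ((Sigma.ι M i).app p).hom (hπ i)).trans (map_zero _)
      rw [Finsupp.sum, map_sum, Finset.sum_congr rfl fun j _ => hproj j (f j) (hf j)] at h1
      simpa using h1
    have h3 := congrArg (fun h => (h.app p).hom x) e.hom_inv_id
    exact h3.symm.trans ((congrArg (fun y => (e.inv.app p).hom y) hzero).trans (map_zero _))

end Decomposition

/-! ### Building an interval summand around a centre -/

section Center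

variable {k : Type u} [Field k] {P : Type} [PartialOrder P]

/-- An interval summand from a centre `p₀`, with a compatible family of vectors below the centre
and a compatible family of functionals above it. -/
theorem nonempty_intervalSummand_of_center (V : PersistenceModule k P) {p₀ : P} {U D : Set P}
    (hU : ∀ p ∈ U, p₀ ≤ p) (hD : ∀ p ∈ D, p ≤ p₀) (hU₀ : p₀ ∈ U) (hD₀ : p₀ ∈ D)
    (w : ∀ p, V.obj p) (ψ : ∀ p, Module.Dual k (V.obj p)) (h₁ : ψ p₀ (w p₀) = 1)
    (hw : ∀ p ∈ D, ∀ q ∈ D, ∀ h : p ≤ q, transition V h (w p) = w q)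
    (hψ : ∀ p ∈ U, ∀ q ∈ U, ∀ (h : p ≤ q) x, ψ q (transition V h x) = ψ p x)
    (hw₀ : ∀ p ∈ D, ∀ q, q ∉ U → q ∉ D → ∀ h : p ≤ q, transition V h (w p) = 0)
    (hψ₀ : ∀ q ∈ U, ∀ p, p ∉ U → p ∉ D → ∀ (h : p ≤ q) x, ψ q (transition V h x) = 0) :
    Nonempty (IntervalSummand V) := by
  classical
  have eq_center {p : P} (hpU : p ∈ U) (hpD : p ∈ D) : p = p₀ :=
    le_antisymm (hD p hpD) (hU p hpU)
  -- The sets `U` and `D` meet only at the centre, where the two prescriptions agree.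
  obtain ⟨v, vU, vD, v0⟩ : ∃ v : ∀ p, V.obj p,
      (∀ p (hp : p ∈ U), v p = transition V (hU p hp) (w p₀)) ∧ (∀ p ∈ D, v p = w p) ∧
      ∀ p, p ∉ U → p ∉ D → v p = 0 := by
    refine ⟨fun p => if hp : p ∈ U then transition V (hU p hp) (w p₀) else
      if p ∈ D then w p else 0, fun p hp => dif_pos hp, fun p hp => ?_, fun p hp hp' => ?_⟩
    · by_cases hpU : p ∈ U
      · obtain rfl := eq_center hpU hp
        simp only [hpU, dif_pos]
        exact transition_refl V _ _
      · simp only [hpU, hp, dif_neg, if_pos, not_false_iff]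
    · simp only [hp, hp', dif_neg, if_neg, not_false_iff]
  obtain ⟨φ, φD, φU, φ0⟩ : ∃ φ : ∀ p, Module.Dual k (V.obj p),
      (∀ p (hp : p ∈ D), φ p = ψ p₀ ∘ₗ transition V (hD p hp)) ∧ (∀ p ∈ U, φ p = ψ p) ∧
      ∀ p, p ∉ U → p ∉ D → φ p = 0 := by
    refine ⟨fun p => if hp : p ∈ D then ψ p₀ ∘ₗ transition V (hD p hp) else
      if p ∈ U then ψ p else 0, fun p hp => dif_pos hp, fun p hp => ?_, fun p hp hp' => ?_⟩
    · by_cases hpD : p ∈ D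
      · obtain rfl := eq_center hp hpD
        simp only [hpD, dif_pos]
        exact LinearMap.ext fun x => congrArg _ (transition_refl V _ _)
      · simp only [hpD, hp, dif_neg, if_pos, not_false_iff]
    · simp only [hp, hp', dif_neg, if_neg, not_false_iff]
  have hv {p q : P} (h : p ≤ q) (hp : p ∈ U ∪ D) : transition V h (v p) = v q := by
    by_cases hqU : q ∈ U
    · rw [vU q hqU]
      rcases hp with hp | hp
      · rw [vU p hp, transition_trans]
      · rw [vD p hp, ← hw p hp p₀ hD₀ (hD p hp), transition_trans]
    · by_cases hqD : q ∈ D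
      · rcases hp with hp | hp
        · have : q = p₀ := le_antisymm (hD q hqD) ((hU p hp).trans h)
          exact (hqU (this ▸ hU₀)).elim
        · rw [vD p hp, vD q hqD, hw p hp q hqD]
      · rw [v0 q hqU hqD]
        rcases hp with hp | hp
        · rw [vU p hp, transition_trans, hw₀ p₀ hD₀ q hqU hqD]
        · rw [vD p hp, hw₀ p hp q hqU hqD]
  have hφ {p q : P} (h : p ≤ q) (hq : q ∈ U ∪ D) (x : V.obj p) :
      φ q (transition V h x) = φ p x := by
    by_cases hpD : p ∈ D
    · rw [φD p hpD, LinearMap.comp_apply]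
      rcases hq with hq | hq
      · rw [φU q hq, ← hψ p₀ hU₀ q hq (hU q hq), transition_trans]
      · rw [φD q hq, LinearMap.comp_apply, transition_trans]
    · by_cases hpU : p ∈ U
      · rcases hq with hq | hq
        · rw [φU p hpU, φU q hq, hψ p hpU q hq]
        · have : p = p₀ := le_antisymm (h.trans (hD q hq)) (hU p hpU)
          exact (hpD (this ▸ hD₀)).elim
      · rw [φ0 p hpU hpD, LinearMap.zero_apply]
        rcases hq with hq | hq
        · rw [φU q hq, hψ₀ q hq p hpU hpD]
        · rw [φD q hq, LinearMap.comp_apply, transition_trans, hψ₀ p₀ hU₀ p hpU hpD]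
  have hφv {p : P} (hp : p ∈ U ∪ D) : φ p (v p) = 1 := by
    rcases hp with hp | hp
    · rw [φU p hp, vU p hp, hψ p₀ hU₀ p hp, h₁]
    · rw [φD p hp, vD p hp, LinearMap.comp_apply, hw p hp p₀ hD₀, h₁]
  have hcomp {p : P} (hp : p ∈ U ∪ D) : p ≤ p₀ ∨ p₀ ≤ p :=
    hp.elim (fun h => Or.inr (hU p h)) fun h => Or.inl (hD p h)
  exact ⟨
    { I :=
        { carrier := U ∪ D
          nonempty := ⟨p₀, Or.inl hU₀⟩
          -- Convexity needs no order argument: if `r` were outside, `v q` would factor through `v r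
          -- = 0`, against `φ q (v q) = 1`.
          convex := fun p hp q hq r hpr hrq => by
            by_contra hr
            have h := hv (hpr.trans hrq) hp
            rw [← transition_trans V hpr hrq, hv hpr hp,
              v0 r (fun h => hr (Or.inl h)) (fun h => hr (Or.inr h)), map_zero] at h
            have := hφv hq
            rw [← h, map_zero] at this
            exact zero_ne_one this
          connected := fun p hp q hq =>
            (Relation.ReflTransGen.single ⟨hp, Or.inl hU₀, hcomp hp⟩).tail
              ⟨Or.inl hU₀, hq, (hcomp hq).symm⟩ }
      v := v
      φ := φ
      transition_v := hv
      φ_transition := hφ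
      v_eq_zero := fun {p} hp => v0 p (fun h => hp (Or.inl h)) (fun h => hp (Or.inr h))
      φ_eq_zero := fun {p} hp => φ0 p (fun h => hp (Or.inl h)) (fun h => hp (Or.inr h))
      φ_v := hφv }⟩

theorem ker_transition_mono (V : PersistenceModule k P) {p q r : P} (hpq : p ≤ q) (hqr : q ≤ r) :
    LinearMap.ker (transition V hpq) ≤ LinearMap.ker (transition V (hpq.trans hqr)) := by
  intro x hx
  rw [LinearMap.mem_ker] at hx ⊢
  rw [← transition_trans V hpq hqr, hx, map_zero]

theorem range_transition_mono (V : PersistenceModule k P) {p q r : P} (hpq : p ≤ q)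
    (hqr : q ≤ r) :
    LinearMap.range (transition V (hpq.trans hqr)) ≤ LinearMap.range (transition V hqr) := by
  rintro _ ⟨x, rfl⟩
  exact ⟨transition V hpq x, transition_trans V hpq hqr x⟩

theorem isChain_ker_transition (V : PersistenceModule k P) (p₀ : P) {Q : Set P}
    (hQ : IsChain (· ≤ ·) Q) :
    IsChain (· ≤ ·) {K | ∃ p ∈ Q, ∃ h : p₀ ≤ p, K = LinearMap.ker (transition V h)} := by
  rintro _ ⟨p, hp, h, rfl⟩ _ ⟨q, hq, h', rfl⟩ -
  exact (hQ.total hp hq).imp (ker_transition_mono V h) (ker_transition_mono V h')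

theorem isChain_range_transition (V : PersistenceModule k P) (p₀ : P) {Q : Set P}
    (hQ : IsChain (· ≤ ·) Q) :
    IsChain (· ≤ ·) {R | ∃ p ∈ Q, ∃ h : p ≤ p₀, R = LinearMap.range (transition V h)} := by
  rintro _ ⟨p, hp, h, rfl⟩ _ ⟨q, hq, h', rfl⟩ -
  exact (hQ.total hp hq).imp (fun hpq => range_transition_mono V hpq h')
    (fun hqp => range_transition_mono V hqp h)

end Center

/-! ### Interval summands over the bipath poset -/

namespace BipathPoset

theorem negInf_le (x : BipathPoset) : negInf ≤ x := Or.inl rfl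

theorem le_posInf (x : BipathPoset) : x ≤ posInf := Or.inr (Or.inl rfl)

theorem pt_le_pt {s t : ℝ} {i j : Fin 2} : pt s i ≤ pt t j ↔ i = j ∧ s ≤ t := by
  constructor
  · rintro (h | h | ⟨s', t', i', h, h', hle⟩)
    · cases h
    · cases h
    · cases h
      cases h'
      exact ⟨rfl, hle⟩
  · rintro ⟨rfl, h⟩
    exact Or.inr (Or.inr ⟨s, t, i, rfl, rfl, h⟩)

theorem not_pt_le_negInf {s : ℝ} {i : Fin 2} : ¬ pt s i ≤ negInf := by
  rintro (h | h | ⟨_, _, _, _, h, _⟩) <;> cases h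

theorem not_posInf_le_pt {s : ℝ} {i : Fin 2} : ¬ posInf ≤ pt s i := by
  rintro (h | h | ⟨_, _, _, h, _, _⟩) <;> cases h

/-- The branches of the bipath poset. -/
def branch (i : Fin 2) : Set BipathPoset := Set.range fun s => pt s i

theorem isChain_branch (i : Fin 2) : IsChain (· ≤ ·) (branch i) := by
  rintro _ ⟨s, rfl⟩ _ ⟨t, rfl⟩ -
  exact (le_total s t).imp (fun h => pt_le_pt.2 ⟨rfl, h⟩) fun h => pt_le_pt.2 ⟨rfl, h⟩

theorem pt_mem_branch (s : ℝ) (i : Fin 2) : pt s i ∈ branch i := ⟨s, rfl⟩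

variable {k : Type u} [Field k] (V : PersistenceModule k BipathPoset)

/-- A vector at -∞ surviving to +∞, with a functional at +∞ detecting it, spreads over the whole
poset. -/
theorem nonempty_intervalSummand_of_ne_zero
    (h : transition V (negInf_le posInf) ≠ 0) : Nonempty (IntervalSummand V) := by
  obtain ⟨v, hv⟩ : ∃ v, transition V (negInf_le posInf) v ≠ 0 := by
    by_contra! hv
    exact h (LinearMap.ext hv)
  obtain ⟨φ, hφ⟩ := Module.Projective.exists_dual_ne_zero k hv
  refine nonempty_intervalSummand_of_center V (p₀ := negInf) (U := Set.univ) (D := {negInf})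
    (fun p _ => negInf_le p) (fun p hp => le_of_eq hp) trivial rfl
    (fun p => transition V (negInf_le p) v)
    (fun p => (φ (transition V (negInf_le posInf) v))⁻¹ • φ ∘ₗ transition V (le_posInf p))
    ?_ ?_ ?_ ?_ ?_
  · simp only [transition_refl, LinearMap.smul_apply, LinearMap.comp_apply, smul_eq_mul]
    exact inv_mul_cancel₀ hφ
  · rintro p rfl q rfl h
    exact transition_trans V _ _ _
  · intro p _ q _ h x
    simp only [LinearMap.smul_apply, LinearMap.comp_apply, transition_trans]
  · exact fun p _ q hq => (hq trivial).elim
  · exact fun q _ p hp => (hp trivial).elim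

/-- `U` collects the points to which `φ` can extend. Since `v` dies at +∞, that point is not in `U`,
so the extensions along the two branches never have to agree at the top. -/
theorem nonempty_intervalSummand_of_negInf (hV : IsPfd V)
    (h₀ : transition V (negInf_le posInf) = 0) [Nontrivial (V.obj negInf)] :
    Nonempty (IntervalSummand V) := by
  have := hV negInf
  obtain ⟨v, φ, hφv, h0, h1⟩ := exists_vector_functional_adapted
    (isChain_ker_transition V negInf (isChain_branch 0))
    (isChain_ker_transition V negInf (isChain_branch 1))
  have hadapt (t : ℝ) (i : Fin 2) : v ∈ LinearMap.ker (transition V (negInf_le (pt t i))) ∨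
      LinearMap.ker (transition V (negInf_le (pt t i))) ≤ LinearMap.ker φ := by
    match i with
    | 0 => exact h0 _ ⟨_, pt_mem_branch t 0, _, rfl⟩
    | 1 => exact h1 _ ⟨_, pt_mem_branch t 1, _, rfl⟩
  let U : Set BipathPoset :=
    {p | LinearMap.ker (transition V (negInf_le p)) ≤ LinearMap.ker φ}
  have hneg : negInf ∈ U := fun x hx => by
    rw [LinearMap.mem_ker, transition_refl] at hx
    simp [hx]
  have hpos : posInf ∉ U := fun h => by
    have : φ v = 0 := h (by rw [h₀, LinearMap.mem_ker, LinearMap.zero_apply])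
    exact one_ne_zero (hφv.symm.trans this)
  have hext (i : Fin 2) := exists_functionals_of_isChain V
    (T := insert negInf (branch i ∩ U))
    (((isChain_branch i).mono Set.inter_subset_left).insert
      fun b _ _ => Or.inl (negInf_le b)) (Set.mem_insert _ _) φ
    (by
      rintro p (rfl | hp) h
      · exact hneg
      · exact hp.2)
  choose ψ hψ₀ hψ using hext
  refine nonempty_intervalSummand_of_center V (p₀ := negInf) (U := U) (D := {negInf})
    (fun p _ => negInf_le p) (fun p hp => le_of_eq hp) hneg rfl
    (fun p => transition V (negInf_le p) v)
    (fun p => match p with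
      | negInf => φ
      | pt t i => ψ i (pt t i)
      | posInf => 0) ?_ ?_ ?_ ?_ ?_
  · simpa only [transition_refl] using hφv
  · rintro p rfl q rfl h
    exact transition_trans V _ _ _
  · rintro p hp q hq h x
    rcases q with _ | ⟨t, i⟩ | _
    · obtain rfl : p = negInf := le_antisymm h (negInf_le p)
      rw [transition_refl]
    · rcases p with _ | ⟨s, j⟩ | _
      · have := hψ i negInf (Set.mem_insert _ _) (pt t i) (Or.inr ⟨pt_mem_branch t i, hq⟩) h x
        rw [hψ₀] at this
        exact this
      · obtain ⟨rfl, -⟩ := pt_le_pt.1 h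
        exact hψ j _ (Or.inr ⟨pt_mem_branch s j, hp⟩) _ (Or.inr ⟨pt_mem_branch t j, hq⟩) h x
      · exact (not_posInf_le_pt h).elim
    · exact (hpos hq).elim
  · rintro p rfl q hq - h
    rw [transition_trans]
    rcases q with _ | ⟨t, i⟩ | _
    · exact (hq hneg).elim
    · exact (hadapt t i).resolve_right hq
    · rw [h₀, LinearMap.zero_apply]
  · intro q hq p hp _ h
    exact (hp ((ker_transition_mono V _ h).trans hq)).elim

/-- Dual to the centre -∞: `D` collects the points to which `v` lifts. It excludes -∞, so the lifts
along the two branches are independent. -/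
theorem nonempty_intervalSummand_of_posInf (hV : IsPfd V)
    (h₀ : transition V (negInf_le posInf) = 0) [Nontrivial (V.obj posInf)] :
    Nonempty (IntervalSummand V) := by
  have := hV posInf
  obtain ⟨v, φ, hφv, h0, h1⟩ := exists_vector_functional_adapted
    (isChain_range_transition V posInf (isChain_branch 0))
    (isChain_range_transition V posInf (isChain_branch 1))
  have hadapt (t : ℝ) (i : Fin 2) : v ∈ LinearMap.range (transition V (le_posInf (pt t i))) ∨
      LinearMap.range (transition V (le_posInf (pt t i))) ≤ LinearMap.ker φ := by
    match i with
    | 0 => exact h0 _ ⟨_, pt_mem_branch t 0, _, rfl⟩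
    | 1 => exact h1 _ ⟨_, pt_mem_branch t 1, _, rfl⟩
  let D : Set BipathPoset := {p | v ∈ LinearMap.range (transition V (le_posInf p))}
  have hpos : posInf ∈ D := ⟨v, transition_refl V _ v⟩
  have hneg : negInf ∉ D := by
    rintro ⟨x, hx⟩
    have hv : (0 : V.obj posInf) = v := by rw [← hx, h₀, LinearMap.zero_apply]
    rw [← hv, map_zero] at hφv
    exact zero_ne_one hφv
  have hext (i : Fin 2) := exists_vectors_of_isChain V hV
    (T := insert posInf (branch i ∩ D))
    (((isChain_branch i).mono Set.inter_subset_left).insert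
      fun b _ _ => Or.inr (le_posInf b)) (Set.mem_insert _ _) v
    (by
      rintro p (rfl | hp) h
      · exact hpos
      · exact hp.2)
  choose w hw₀ hw using hext
  refine nonempty_intervalSummand_of_center V (p₀ := posInf) (U := {posInf}) (D := D)
    (fun p hp => ge_of_eq hp) (fun p _ => le_posInf p) rfl hpos
    (fun p => match p with
      | negInf => 0
      | pt t i => w i (pt t i)
      | posInf => v)
    (fun p => φ ∘ₗ transition V (le_posInf p)) ?_ ?_ ?_ ?_ ?_
  · simpa only [LinearMap.comp_apply, transition_refl] using hφv
  · rintro p hp q hq h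
    rcases p with _ | ⟨s, i⟩ | _
    · exact (hneg hp).elim
    · rcases q with _ | ⟨t, j⟩ | _
      · exact (hneg hq).elim
      · obtain ⟨rfl, -⟩ := pt_le_pt.1 h
        exact hw i _ (Or.inr ⟨pt_mem_branch s i, hp⟩) _ (Or.inr ⟨pt_mem_branch t i, hq⟩) h
      · exact (hw i (pt s i) (Or.inr ⟨pt_mem_branch s i, hp⟩) posInf (Set.mem_insert _ _) h).trans
          (hw₀ i)
    · obtain rfl : q = posInf := le_antisymm (le_posInf q) h
      exact transition_refl V _ _
  · rintro p rfl q rfl h x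
    rw [transition_refl]
  · intro p hp q _ hq h
    exact (hq (range_transition_mono V h _ hp)).elim
  · rintro q rfl p - hp h x
    rw [LinearMap.comp_apply, transition_refl]
    rcases p with _ | ⟨t, i⟩ | _
    · rw [h₀, LinearMap.zero_apply, map_zero]
    · exact (hadapt t i).resolve_left hp (LinearMap.mem_range_self _ x)
    · exact (hp hpos).elim

/-- With both end spaces zero, `U` and `D` stay inside one branch, and the two chains are the
kernels and the images at the chosen point. -/
theorem nonempty_intervalSummand_of_pt (hV : IsPfd V) [Subsingleton (V.obj negInf)]
    [Subsingleton (V.obj posInf)] (r : ℝ) (i : Fin 2) [Nontrivial (V.obj (pt r i))] :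
    Nonempty (IntervalSummand V) := by
  have := hV (pt r i)
  obtain ⟨v, φ, hφv, h0, h1⟩ := exists_vector_functional_adapted
    (isChain_ker_transition V (pt r i) (isChain_branch i))
    (isChain_range_transition V (pt r i) (isChain_branch i))
  let U : Set BipathPoset :=
    {p | ∃ h : pt r i ≤ p, LinearMap.ker (transition V h) ≤ LinearMap.ker φ}
  let D : Set BipathPoset := {p | ∃ h : p ≤ pt r i, v ∈ LinearMap.range (transition V h)}
  have hU₀ : pt r i ∈ U := ⟨le_rfl, fun x hx => by
    rw [LinearMap.mem_ker, transition_refl] at hx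
    simp [hx]⟩
  have hD₀ : pt r i ∈ D := ⟨le_rfl, v, transition_refl V _ v⟩
  have hUb : U ⊆ branch i := by
    rintro (_ | ⟨t, j⟩ | _) ⟨h, hp⟩
    · exact (not_pt_le_negInf h).elim
    · obtain ⟨rfl, -⟩ := pt_le_pt.1 h
      exact pt_mem_branch t i
    · have : φ v = 0 := hp (LinearMap.mem_ker.2 (Subsingleton.elim _ _))
      exact (one_ne_zero (hφv.symm.trans this)).elim
  have hDb : D ⊆ branch i := by
    rintro (_ | ⟨t, j⟩ | _) ⟨h, x, hx⟩
    · rw [Subsingleton.elim x 0, map_zero] at hx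
      rw [← hx, map_zero] at hφv
      exact (zero_ne_one hφv).elim
    · obtain ⟨rfl, -⟩ := pt_le_pt.1 h
      exact pt_mem_branch t j
    · exact (not_posInf_le_pt h).elim
  obtain ⟨ψ, hψ₀, hψ⟩ := exists_functionals_of_isChain V ((isChain_branch i).mono hUb) hU₀ φ
    fun p hp _ => hp.2
  obtain ⟨w, hw₀, hw⟩ := exists_vectors_of_isChain V hV ((isChain_branch i).mono hDb) hD₀ v
    fun p hp _ => hp.2
  refine nonempty_intervalSummand_of_center V (fun p hp => hp.1) (fun p hp => hp.1) hU₀ hD₀ w ψ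
    (by rw [hψ₀, hw₀, hφv]) hw hψ ?_ ?_
  · intro p hp q hqU hqD h
    obtain ⟨s, rfl⟩ := hDb hp
    rcases q with _ | ⟨t, j⟩ | _
    · exact (not_pt_le_negInf h).elim
    · obtain ⟨rfl, -⟩ := pt_le_pt.1 h
      -- Below the centre, `q` would inherit membership in `D` from `p`; above it, failure of `φ` to
      -- extend makes adaptedness kill `v`.
      rcases le_total t r with htr | htr
      · exact (hqD ⟨pt_le_pt.2 ⟨rfl, htr⟩, range_transition_mono V h _ hp.2⟩).elim
      · have hle : pt r i ≤ pt t i := pt_le_pt.2 ⟨rfl, htr⟩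
        have hv := (h0 _ ⟨_, pt_mem_branch t i, hle, rfl⟩).resolve_right fun h => hqU ⟨hle, h⟩
        rw [← transition_trans V hp.1 hle, hw _ hp _ hD₀, hw₀]
        exact hv
    · exact Subsingleton.elim _ _
  · intro q hq p hpU hpD h x
    obtain ⟨t, rfl⟩ := hUb hq
    rcases p with _ | ⟨s, j⟩ | _
    · rw [Subsingleton.elim x 0, map_zero, map_zero]
    · obtain ⟨rfl, -⟩ := pt_le_pt.1 h
      rcases le_total r s with hrs | hrs
      · exact (hpU ⟨pt_le_pt.2 ⟨rfl, hrs⟩, (ker_transition_mono V _ h).trans hq.2⟩).elim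
      · have hle : pt s j ≤ pt r j := pt_le_pt.2 ⟨rfl, hrs⟩
        have hR := (h1 _ ⟨_, pt_mem_branch s j, hle, rfl⟩).resolve_left fun h => hpD ⟨hle, h⟩
        rw [← transition_trans V hle hq.1, hψ _ hU₀ _ hq, hψ₀]
        exact hR (LinearMap.mem_range_self _ x)
    · exact (not_posInf_le_pt h).elim

/-- Every nonzero pointwise finite-dimensional bipath persistence module has an interval
summand. -/
theorem nonempty_intervalSummand (hV : IsPfd V) (h : ∃ p, Nontrivial (V.obj p)) :
    Nonempty (IntervalSummand V) := by
  by_cases h₀ : transition V (negInf_le posInf) = 0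
  · rcases subsingleton_or_nontrivial (V.obj negInf) with hn | hn
    · rcases subsingleton_or_nontrivial (V.obj posInf) with hp | hp
      · obtain ⟨_ | ⟨r, i⟩ | _, h⟩ := h
        · exact (not_nontrivial _ h).elim
        · exact nonempty_intervalSummand_of_pt V hV r i
        · exact (not_nontrivial _ h).elim
      · exact nonempty_intervalSummand_of_posInf V hV h₀
    · exact nonempty_intervalSummand_of_negInf V hV h₀
  · exact nonempty_intervalSummand_of_ne_zero V h₀

end BipathPoset

theorem theorem3p4 {k : Type u} [Field k] (V : PersistenceModule k BipathPoset) (hV : IsPfd V) :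
    (∃ (Λ : Type u) (M : Λ → PersistenceModule k BipathPoset), IsIntervalDecomposition V M) ∧
    (∀ (Λ Γ : Type u) (M : Λ → PersistenceModule k BipathPoset)
      (N : Γ → PersistenceModule k BipathPoset),
      IsIntervalDecomposition V M → IsIntervalDecomposition V N →
        ∃ σ : Λ ≃ Γ, ∀ i : Λ, Nonempty (M i ≅ N (σ i))) := by
  refine ⟨?_, fun Λ Γ M N hM hN => ?_⟩
  · obtain ⟨Λ, s, hs, hc⟩ := IntervalSummand.exists_orthogonal_complete
      BipathPoset.nonempty_intervalSummand hV
    exact ⟨Λ, _, hs.isIntervalDecomposition hc hV⟩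
  · obtain ⟨s, hs, hsc, hsM⟩ := hM.exists_orthogonal_complete
    obtain ⟨t, ht, htc, htN⟩ := hN.exists_orthogonal_complete
    obtain ⟨σ, hσ⟩ := IntervalSummand.exists_equiv hs hsc ht htc hV
    refine ⟨σ, fun i => ?_⟩
    obtain ⟨a⟩ := hsM i
    obtain ⟨b⟩ := htN (σ i)
    rw [hσ i] at b
    exact ⟨a ≪≫ b.symm⟩
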